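/- For integers $\xi\neq 0$ and $\eta$ let $\omega(\xi,\eta)=\xi^3-\eta^2/\xi$. Equip $\mathbb{R}\times\mathbb{Z}^2$, with points $(\tau,\xi,\eta)$, with the product of Lebesgue measure and counting measures, and let $f_1*f_2$ denote convolution on this group. For every $c\ge 1$ there are constants $K,C>0$ depending only on $c$ such that the following holds. Let $\alpha\le 1$ and $D^*\ge 2$ be real, let $N_1,N_2,L_1,L_2\in 2^{\mathbb{N}_0}$ be dyadic numbers, put $L_{\max}=\max(L_1,L_2)$, and suppose that $$K N_2\le N_1,\qquad N_1^{\alpha}\le L_{\max}\le c\,N_1^2N_2 .$$ Let $f_1,f_2:\mathbb{R}\times\mathbb{Z}\times\mathbb{Z}\to\mathbb{C}$ be in $L^2(\mathbb{R}\times\mathbb{Z}^2)$ and such that for all $(\tau_i,\xi_i,\eta_i)\in\operatorname{supp}(f_i)$, $i=1,2$, $$c^{-1}N_i\le|\xi_i|\le c\,N_i,\qquad |\tau_i-\omega(\xi_i,\eta_i)|\le c\,L_i,\qquad \Big|\frac{\eta_1}{\xi_1}-\frac{\eta_2}{\xi_2}\Big|\le c\,D^* .$$ Then the integral defining $f_1*f_2$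 converges absolutely at every point, $f_1*f_2\in L^2(\mathbb{R}\times\mathbb{Z}^2)$, and $$\|f_1*f_2\|_{L^2(\mathbb{R}\times\mathbb{Z}^2)}\le C\,\log(D^*)\,\big(N_2^{1/2}N_1^{-\alpha/2}+N_2^{1/4}N_1^{-\alpha/4}\big)\prod_{i=1}^2L_i^{1/2}\|f_i\|_{L^2(\mathbb{R}\times\mathbb{Z}^2)} .$$ -/

import Mathlib

noncomputable section

namespace KPII

/-- Frequency space `ℝ × ℤ × ℤ` with points `(τ, ξ, η)`. -/
abbrev Freq : Type := ℝ × ℤ × ℤ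

/-- Lebesgue measure in `τ` times counting measure in `ξ` and in `η`. -/
def freqMeasure : MeasureTheory.Measure Freq :=
  (MeasureTheory.volume : MeasureTheory.Measure ℝ).prod
    ((MeasureTheory.Measure.count : MeasureTheory.Measure ℤ).prod
      (MeasureTheory.Measure.count : MeasureTheory.Measure ℤ))

/-- The dispersion relation `ω(ξ, η) = ξ³ - η² / ξ`, only used for `ξ ≠ 0`. -/
def omega (ξ η : ℤ) : ℝ := (ξ : ℝ) ^ 3 - (η : ℝ) ^ 2 / (ξ : ℝ)

/-- Dyadic numbers: the elements of `2^{ℕ₀}`. -/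
def IsDyadic (x : ℝ) : Prop := ∃ k : ℕ, x = 2 ^ k

/-- On the support of `f` one has `|ξ| ∼ N` and `|τ - ω(ξ, η)| ≲ L`, both with implicit
constant `c`. -/
def LocalizedAt (c N L : ℝ) (f : Freq → ℂ) : Prop :=
  ∀ τ : ℝ, ∀ ξ η : ℤ, (τ, ξ, η) ∈ Function.support f →
    (N / c ≤ |(ξ : ℝ)| ∧ |(ξ : ℝ)| ≤ c * N) ∧ |τ - omega ξ η| ≤ c * L

/-- `|η₁ / ξ₁ - η₂ / ξ₂| ≲ D` with implicit constant `c`, for all pairs of points of the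
supports. -/
def TransversalityLE (c D : ℝ) (f₁ f₂ : Freq → ℂ) : Prop :=
  ∀ τ₁ τ₂ : ℝ, ∀ ξ₁ η₁ ξ₂ η₂ : ℤ,
    (τ₁, ξ₁, η₁) ∈ Function.support f₁ → (τ₂, ξ₂, η₂) ∈ Function.support f₂ →
      |(η₁ : ℝ) / (ξ₁ : ℝ) - (η₂ : ℝ) / (ξ₂ : ℝ)| ≤ c * D

end KPII

end

open MeasureTheory

namespace KPII

/-! By Cauchy–Schwarz and Tonelli, `‖f₁ * f₂‖² ≤ sup_x μ(E_x) ‖f₁‖² ‖f₂‖²`, where `E_x` contains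
every `t` with `f₁ t ≠ 0` and `f₂ (x - t) ≠ 0` (`lintegral_sq_convolution_le`). Over each `(ξ₁, η₁)`
this set fits in a `τ`-interval of length `2c min(L₁, L₂)`, so everything rests on counting the
pairs `(ξ₁, η₁)` whose resonance function is `O(L)`, `L = max(L₁, L₂)`.

Write `N = N₁`, `n = N₂`. For fixed `ξ₁ = p` the square of an affine function of `η₁` with slope `≳
1/n` must lie within `O(L/n)` of a center `A_p`. This leaves `O(1 + √(Ln))` values of `η₁`, and also
`O(1 + L/√|A_p|)`. The centers are spread out: if `q` minimises `|A_q|`, then `|A_p| ≳ N²|p - q|/n`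
(`FreqBounds.center_lower`). Only `p = q` costs `√(Ln)`; the other `p` contribute `O(n + Ln/N)`
because `∑ k^(-1/2) ≲ √n` over `k ≲ n`. The total `n + √(Ln) + Ln/N` (`exists_finset_resonantSet`)
becomes the claimed bound through `L ≥ N^α` and `α ≤ 1`. -/

/-! ### Counting integers at which a quadratic is close to a given value -/

/-- A set of integers of diameter at most `d / a` has at most `1 + d / a` elements. -/
lemma exists_finset_card_le_of_dist_le (T : Set ℤ) {a d : ℝ} (ha : 0 < a) (hd : 0 ≤ d)
    (h : ∀ m ∈ T, ∀ n ∈ T, a * |(m : ℝ) - n| ≤ d) :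
    ∃ F : Finset ℤ, T ⊆ F ∧ (F.card : ℝ) ≤ 1 + d / a := by
  have hda : 0 ≤ d / a := div_nonneg hd ha.le
  rcases T.eq_empty_or_nonempty with rfl | ⟨p, hp⟩
  · exact ⟨∅, by simp, by simp only [Finset.card_empty, Nat.cast_zero]; linarith⟩
  have hdist : ∀ m ∈ T, ∀ n ∈ T, (m : ℝ) - n ≤ d / a := fun m hm n hn => by
    rw [le_div_iff₀ ha, mul_comm]
    exact (mul_le_mul_of_nonneg_left (le_abs_self _) ha.le).trans (h m hm n hn)
  obtain ⟨q, hq, hmin⟩ := Int.exists_least_of_bdd (P := fun n => n ∈ T)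
    ⟨p - ⌊d / a⌋, fun n hn => by
      have : p - n ≤ ⌊d / a⌋ := Int.le_floor.2 (by push_cast; exact hdist p hp n hn)
      linarith⟩ ⟨p, hp⟩
  refine ⟨Finset.Icc q (q + ⌊d / a⌋), fun n hn => ?_, ?_⟩
  · have : n - q ≤ ⌊d / a⌋ := Int.le_floor.2 (by push_cast; exact hdist n hn q hq)
    simp only [Finset.coe_Icc, Set.mem_Icc]
    exact ⟨hmin n hn, by linarith⟩
  · have h0 : 0 ≤ ⌊d / a⌋ := Int.floor_nonneg.2 hda
    rw [Int.card_Icc]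
    have : (((q + ⌊d / a⌋ + 1 - q).toNat : ℤ) : ℝ) = ⌊d / a⌋ + 1 := by
      rw [Int.toNat_of_nonneg (by linarith)]; push_cast; ring
    rw [Int.cast_natCast] at this
    rw [this]
    linarith [Int.floor_le (d / a)]

/-- Integers `n` for which `(a n + b)²` lies near `A` are few, if the nonnegative reals whose
square lies near `A` are at mutual distance at most `d`. -/
lemma exists_finset_card_le_of_sq_near {a a₀ b A r d : ℝ} (ha : 0 < a₀) (haa : a₀ ≤ |a|)
    (hd : 0 ≤ d)
    (h : ∀ x y : ℝ, 0 ≤ x → 0 ≤ y → |x ^ 2 - A| ≤ r → |y ^ 2 - A| ≤ r → |x - y| ≤ d) :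
    ∃ F : Finset ℤ, {n : ℤ | |(a * n + b) ^ 2 - A| ≤ r} ⊆ F ∧ (F.card : ℝ) ≤ 2 * (1 + d / a₀) := by
  have key : ∀ m n : ℤ, |(a * m + b) - (a * n + b)| ≤ d → a₀ * |(m : ℝ) - n| ≤ d := by
    intro m n hmn
    have : (a * m + b) - (a * n + b) = a * ((m : ℝ) - n) := by ring
    rw [this, abs_mul] at hmn
    exact (mul_le_mul_of_nonneg_right haa (abs_nonneg _)).trans hmn
  -- The two signs of `a n + b` are counted separately, whence the factor 2.
  obtain ⟨F, hF, hFc⟩ := exists_finset_card_le_of_dist_le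
    {n : ℤ | 0 ≤ a * n + b ∧ |(a * n + b) ^ 2 - A| ≤ r} ha hd
    (fun m hm n hn => key m n (h _ _ hm.1 hn.1 hm.2 hn.2))
  obtain ⟨G, hG, hGc⟩ := exists_finset_card_le_of_dist_le
    {n : ℤ | a * n + b ≤ 0 ∧ |(a * n + b) ^ 2 - A| ≤ r} ha hd
    (fun m hm n hn => key m n (by
      have := h (-(a * m + b)) (-(a * n + b)) (by linarith [hm.1]) (by linarith [hn.1])
        (by rw [neg_sq]; exact hm.2) (by rw [neg_sq]; exact hn.2)
      rwa [← abs_neg, show -((a * (m : ℝ) + b) - (a * n + b)) =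
        -(a * m + b) - -(a * n + b) by ring]))
  refine ⟨F ∪ G, fun n hn => ?_, ?_⟩
  · rcases le_total 0 (a * n + b) with h0 | h0
    · exact Finset.mem_coe.2 (Finset.mem_union_left _ (hF ⟨h0, hn⟩))
    · exact Finset.mem_coe.2 (Finset.mem_union_right _ (hG ⟨h0, hn⟩))
  · have : ((F ∪ G).card : ℝ) ≤ F.card + G.card := by exact_mod_cast Finset.card_union_le F G
    linarith

/-- For nonnegative reals `|x - y|² ≤ |x - y| (x + y) = |x² - y²|`. -/
lemma sq_abs_sub_le_of_sq_near {x y A r : ℝ} (hx : 0 ≤ x) (hy : 0 ≤ y)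
    (hxA : |x ^ 2 - A| ≤ r) (hyA : |y ^ 2 - A| ≤ r) : |x - y| ^ 2 ≤ 2 * r := by
  rw [abs_le] at hxA hyA
  rw [sq_abs]
  rcases le_total x y with h | h <;> nlinarith

/-- If `|A| ≤ 2r`, the preceding bound suffices. Otherwise `A > 0` and `(x + y)² ≥ x² + y² ≥ 2A - 2r
≥ A`, so `x + y` may replace `√A` in `|x - y| (x + y) ≤ 2r`. -/
lemma abs_sub_mul_sqrt_le_of_sq_near {x y A r : ℝ} (hx : 0 ≤ x) (hy : 0 ≤ y)
    (hxA : |x ^ 2 - A| ≤ r) (hyA : |y ^ 2 - A| ≤ r) : |x - y| * √|A| ≤ 2 * r := by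
  have hr : 0 ≤ r := (abs_nonneg _).trans hxA
  have hsq := sq_abs_sub_le_of_sq_near hx hy hxA hyA
  apply abs_le_of_sq_le_sq' _ (by linarith) |>.2
  rw [mul_pow, Real.sq_sqrt (abs_nonneg _)]
  rcases le_or_gt |A| (2 * r) with hA | hA
  · nlinarith [abs_nonneg A]
  · rw [abs_le] at hxA hyA
    have hA0 : 0 ≤ A := by
      by_contra hneg
      rw [abs_of_neg (not_le.1 hneg)] at hA
      nlinarith
    rw [abs_of_nonneg hA0] at hA ⊢
    have h1 : A ≤ (x + y) ^ 2 := by nlinarith [mul_nonneg hx hy]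
    calc |x - y| ^ 2 * A ≤ |x - y| ^ 2 * (x + y) ^ 2 := by gcongr
      _ = (x ^ 2 - y ^ 2) ^ 2 := by rw [sq_abs]; ring
      _ ≤ (2 * r) ^ 2 := sq_le_sq' (by linarith) (by linarith)

/-! ### Sums of inverse square roots -/

lemma sum_Icc_inv_sqrt_le (m : ℕ) : ∑ k ∈ Finset.Icc 1 m, 1 / √(k : ℝ) ≤ 2 * √(m : ℝ) := by
  induction m with
  | zero => simp
  | succ m ih =>
    rw [Finset.sum_Icc_succ_top (by omega)]
    have hs : 0 < √((m + 1 : ℕ) : ℝ) := Real.sqrt_pos.2 (by positivity)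
    have h1 : √((m + 1 : ℕ) : ℝ) ^ 2 = m + 1 := by
      rw [Real.sq_sqrt (by positivity)]; push_cast; ring
    have h2 : √(m : ℝ) ^ 2 = m := Real.sq_sqrt (by positivity)
    have h3 : 1 / √((m + 1 : ℕ) : ℝ) ≤ 2 * √((m + 1 : ℕ) : ℝ) - 2 * √(m : ℝ) := by
      rw [div_le_iff₀ hs]
      nlinarith [sq_nonneg (√((m + 1 : ℕ) : ℝ) - √(m : ℝ))]
    linarith

lemma sum_inv_sqrt_abs_sub_le (X : Finset ℤ) (p : ℤ) (m : ℕ) (h : ∀ q ∈ X, |q - p| ≤ m) :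
    ∑ q ∈ X.erase p, 1 / √|((q : ℝ) - p)| ≤ 4 * √(m : ℝ) := by
  have hsub : X.erase p ⊆ (Finset.Icc 1 m).image (fun k : ℕ => p + (k : ℤ)) ∪
      (Finset.Icc 1 m).image (fun k : ℕ => p - (k : ℤ)) := by
    intro q hq
    rw [Finset.mem_erase] at hq
    have hq2 := h q hq.2
    rw [abs_le] at hq2
    simp only [Finset.mem_union, Finset.mem_image, Finset.mem_Icc]
    rcases lt_or_gt_of_ne hq.1 with hlt | hgt
    · exact Or.inr ⟨(p - q).toNat, by omega, by omega⟩
    · exact Or.inl ⟨(q - p).toNat, by omega, by omega⟩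
  have hnn : ∀ q : ℤ, 0 ≤ 1 / √|((q : ℝ) - p)| := fun q => by positivity
  have hunion : ∀ s t : Finset ℤ, ∑ q ∈ s ∪ t, 1 / √|((q : ℝ) - p)| ≤
      ∑ q ∈ s, 1 / √|((q : ℝ) - p)| + ∑ q ∈ t, 1 / √|((q : ℝ) - p)| := fun s t => by
    rw [← Finset.sum_union_inter]
    linarith [Finset.sum_nonneg (s := s ∩ t) (fun q _ => hnn q)]
  refine (Finset.sum_le_sum_of_subset_of_nonneg hsub (fun q _ _ => hnn q)).trans
    ((hunion _ _).trans ?_)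
  rw [Finset.sum_image (by intro i _ j _ hij; simpa using hij),
    Finset.sum_image (by intro i _ j _ hij; simpa using hij)]
  have h1 := sum_Icc_inv_sqrt_le m
  simp only [Int.cast_add, Int.cast_sub, Int.cast_natCast, add_sub_cancel_left, sub_sub_cancel_left,
    abs_neg, Nat.abs_cast]
  linarith

/-! ### The resonance function and the separation of its centers -/

/-- With `ξ₂ = ξ - ξ₁`, `η₂ = η - η₁`, the resonance function is quadratic in
the transversality `η₁ / ξ₁ - η₂ / ξ₂`. -/
lemma sub_omega_sub_omega_eq (τ : ℝ) {ξ ξ₁ : ℤ} (η η₁ : ℤ) (hξ : ξ ≠ 0) (h₁ : ξ₁ ≠ 0)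
    (h₂ : ξ - ξ₁ ≠ 0) :
    τ - omega ξ₁ η₁ - omega (ξ - ξ₁) (η - η₁) =
      ((ξ₁ : ℝ) * (ξ - ξ₁) / ξ) *
        (((ξ : ℝ) / (ξ₁ * (ξ - ξ₁)) * η₁ + -((η : ℝ) / (ξ - ξ₁))) ^ 2 -
          (((ξ : ℝ) ^ 3 - (η : ℝ) ^ 2 / ξ - τ) * ξ / (ξ₁ * (ξ - ξ₁)) - 3 * (ξ : ℝ) ^ 2)) := by
  have hξ' : (ξ : ℝ) ≠ 0 := by exact_mod_cast hξ
  have h₁' : (ξ₁ : ℝ) ≠ 0 := by exact_mod_cast h₁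
  have h₂' : (ξ : ℝ) - ξ₁ ≠ 0 := by exact_mod_cast h₂
  unfold omega
  push_cast
  field_simp
  ring

/-- Bounds on the frequencies `p` and `x - p` of two waves interacting to frequency `x`. -/
structure FreqBounds (c N n x p : ℝ) : Prop where
  fst_lower : N / c ≤ |p|
  fst_upper : |p| ≤ c * N
  snd_lower : n / c ≤ |x - p|
  snd_upper : |x - p| ≤ c * n

/-- This is where `K = 4c²` comes from: the second frequency is at most a quarter of the first, so
sums and differences of the two keep size `N`. -/
lemma snd_upper_le {c N n : ℝ} (hc : 1 ≤ c) (hN : 4 * c ^ 2 * n ≤ N) : c * n ≤ N / c / 4 := by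
  rw [div_div, le_div_iff₀ (by positivity)]
  nlinarith

namespace FreqBounds

variable {c N n x p q : ℝ}

lemma output_lower (h : FreqBounds c N n x p) (hc : 1 ≤ c) (hn : 1 ≤ n)
    (hN : 4 * c ^ 2 * n ≤ N) : N / c / 2 ≤ |x| := by
  have h1 := snd_upper_le hc hN
  have h2 : |p| ≤ |x| + |x - p| := by
    have := abs_sub_abs_le_abs_sub p x
    rw [abs_sub_comm p x] at this
    linarith
  have := h.fst_lower
  have := h.snd_upper
  have : 0 < c * n := by positivity
  linarith

/-- Needed because `p (x - p) - q (x - q) = (p - q)(x - q - p)`: it keeps the denominators of two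
centers apart. -/
lemma fst_sub_snd_lower (h : FreqBounds c N n x p) (h' : FreqBounds c N n x q) (hc : 1 ≤ c)
    (hn : 1 ≤ n) (hN : 4 * c ^ 2 * n ≤ N) : N / c / 2 ≤ |x - q - p| := by
  have h1 := snd_upper_le hc hN
  have h2 := abs_sub_abs_le_abs_sub p (x - q)
  rw [abs_sub_comm p (x - q)] at h2
  have := h.fst_lower
  have := h'.snd_upper
  have : 0 < c * n := by positivity
  linarith

lemma fst_pos (h : FreqBounds c N n x p) (hc : 1 ≤ c) (hN : 0 < N) : 0 < |p| :=
  lt_of_lt_of_le (by positivity) h.fst_lower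

lemma snd_pos (h : FreqBounds c N n x p) (hc : 1 ≤ c) (hn : 0 < n) : 0 < |x - p| :=
  lt_of_lt_of_le (by positivity) h.snd_lower

lemma ratio_lower (h : FreqBounds c N n x p) (hc : 1 ≤ c) (hn : 1 ≤ n)
    (hN : 4 * c ^ 2 * n ≤ N) : 1 / (2 * c ^ 3 * n) ≤ |x / (p * (x - p))| := by
  have hN0 : 0 < N := lt_of_lt_of_le (by positivity) hN
  have hp := h.fst_pos hc hN0
  have hs := h.snd_pos hc (by linarith)
  rw [abs_div, abs_mul, div_le_div_iff₀ (by positivity) (by positivity)]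
  have h1 : |p| * |x - p| ≤ (c * N) * (c * n) :=
    mul_le_mul h.fst_upper h.snd_upper hs.le (by positivity)
  have h2 := mul_le_mul_of_nonneg_right (h.output_lower hc hn hN)
    (show 0 ≤ 2 * c ^ 3 * n by positivity)
  have h3 : N / c / 2 * (2 * c ^ 3 * n) = (c * N) * (c * n) := by field_simp
  linarith

lemma ratio_upper (h : FreqBounds c N n x p) (hc : 1 ≤ c) (hn : 1 ≤ n)
    (hN : 4 * c ^ 2 * n ≤ N) : |x / (p * (x - p))| ≤ 2 * c / n := by
  have hN0 : 0 < N := lt_of_lt_of_le (by positivity) hN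
  have hp := h.fst_pos hc hN0
  have hs := h.snd_pos hc (by linarith)
  rw [abs_div, abs_mul, div_le_div_iff₀ (by positivity) (by positivity)]
  have h0 : |x| ≤ |p| + |x - p| := by
    simpa using abs_add_le p (x - p)
  have h1 : n ≤ c * |x - p| := by
    have := h.snd_lower
    rw [div_le_iff₀ (by positivity)] at this
    linarith
  have h2 : n ≤ c * |p| := by
    have := h.fst_lower
    rw [div_le_iff₀ (by positivity)] at this
    have hc2 : 1 ≤ c ^ 2 := one_le_pow₀ hc
    nlinarith
  nlinarith [mul_le_mul_of_nonneg_right h0 (by linarith : 0 ≤ n),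
    mul_le_mul_of_nonneg_left h1 hp.le, mul_le_mul_of_nonneg_left h2 hs.le]

/-- The centers `b / (p (x - p)) - 3 x²` are well separated as `p` varies. -/
lemma center_lower (h : FreqBounds c N n x p) (h' : FreqBounds c N n x q) (hc : 1 ≤ c)
    (hn : 1 ≤ n) (hN : 4 * c ^ 2 * n ≤ N) {b : ℝ}
    (hle : |b / (q * (x - q)) - 3 * x ^ 2| ≤ |b / (p * (x - p)) - 3 * x ^ 2|) :
    N ^ 2 * |p - q| / (8 * c ^ 5 * n) ≤ |b / (p * (x - p)) - 3 * x ^ 2| := by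
  have hN0 : 0 < N := lt_of_lt_of_le (by positivity) hN
  have hp := h.fst_pos hc hN0
  have hs := h.snd_pos hc (by linarith)
  have hp' := h'.fst_pos hc hN0
  have hs' := h'.snd_pos hc (by linarith)
  have hx := h.output_lower hc hn hN
  have hx2 : (N / c / 2) ^ 2 ≤ x ^ 2 := by
    rw [← sq_abs x]
    exact pow_le_pow_left₀ (by positivity) hx 2
  set A := b / (p * (x - p)) - 3 * x ^ 2 with hA
  -- If `|A| ≤ x²`, then `b / (p (x - p)) ≥ 2x²`, which makes the difference of the two centers at
  -- least of order `N² |p - q| / n`; by minimality at `q` that difference is at most `2|A|`.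
  rcases le_or_gt |A| (x ^ 2) with hAx | hAx
  · have hu : 2 * x ^ 2 ≤ |b / (p * (x - p))| := by
      refine le_trans ?_ (le_abs_self _)
      have := (abs_le.1 hAx).1
      linarith
    have hp0 := abs_pos.1 hp
    have hs0 := abs_pos.1 hs
    have hp0' := abs_pos.1 hp'
    have hs0' := abs_pos.1 hs'
    have hdiff : A - (b / (q * (x - q)) - 3 * x ^ 2) =
        b / (p * (x - p)) * ((p - q) * (-(x - q - p)) / (q * (x - q))) := by
      rw [hA]
      field_simp
      ring
    have h2A : |A - (b / (q * (x - q)) - 3 * x ^ 2)| ≤ 2 * |A| :=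
      (abs_sub _ _).trans (by linarith)
    rw [hdiff, abs_mul, abs_div ((p - q) * _), abs_mul (p - q), abs_mul q, abs_neg] at h2A
    have hw := h.fst_sub_snd_lower h' hc hn hN
    have hden : |q| * |x - q| ≤ (c * N) * (c * n) :=
      mul_le_mul h'.fst_upper h'.snd_upper hs'.le (by positivity)
    have hfrac : |p - q| * (N / c / 2) / ((c * N) * (c * n)) ≤
        |p - q| * |x - q - p| / (|q| * |x - q|) := by gcongr
    have h3 : 2 * (N / c / 2) ^ 2 * (|p - q| * (N / c / 2) / ((c * N) * (c * n))) ≤ 2 * |A| := by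
      refine le_trans ?_ h2A
      refine mul_le_mul (by linarith) hfrac (by positivity) (abs_nonneg _)
    have h4 : 2 * (N / c / 2) ^ 2 * (|p - q| * (N / c / 2) / ((c * N) * (c * n))) =
        2 * (N ^ 2 * |p - q| / (8 * c ^ 5 * n)) := by
      ring_nf
      field_simp
    linarith
  -- Here `|A|` already exceeds `x² ≳ N²`, and `|p - q| ≤ 2cn` makes the claimed lower bound no
  -- larger.
  · refine le_trans ?_ (hx2.trans hAx.le)
    have hk : |p - q| ≤ 2 * c * n := by
      have := abs_sub (x - q) (x - p)
      rw [show x - q - (x - p) = p - q by ring] at this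
      linarith [h.snd_upper, h'.snd_upper]
    have hc3 : c * c ^ 2 ≤ c ^ 5 := by
      rw [← pow_succ']; exact pow_le_pow_right₀ hc (by norm_num)
    rw [div_le_iff₀ (by positivity)]
    calc N ^ 2 * |p - q| ≤ N ^ 2 * (2 * c * n) := by gcongr
      _ = (N / c / 2) ^ 2 * (8 * (c * c ^ 2) * n) := by field_simp; norm_num
      _ ≤ (N / c / 2) ^ 2 * (8 * c ^ 5 * n) := by gcongr

end FreqBounds

/-! ### Counting resonant pairs -/

/-- The pairs `(ξ₁, η₁)` that contribute to the output `(τ, ξ, η)`. -/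
def resonantSet (c N n M τ : ℝ) (ξ η : ℤ) : Set (ℤ × ℤ) :=
  {p | FreqBounds c N n ξ p.1 ∧ |τ - omega p.1 p.2 - omega (ξ - p.1) (η - p.2)| ≤ M}

/-- The value of `(η₁ / ξ₁ - η₂ / ξ₂)²` at exact resonance, for `ξ₁ = p`. -/
noncomputable def resonanceCenter (τ : ℝ) (ξ η p : ℤ) : ℝ :=
  ((ξ : ℝ) ^ 3 - (η : ℝ) ^ 2 / ξ - τ) * ξ / (p * (ξ - p)) - 3 * (ξ : ℝ) ^ 2

/-- Each fibre of the resonant set over a fixed `ξ₁`. -/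
lemma exists_finset_fibre {c N n L τ : ℝ} {ξ η p : ℤ} (hc : 1 ≤ c) (hn : 1 ≤ n)
    (hN : 4 * c ^ 2 * n ≤ N) (h : FreqBounds c N n ξ p) {d : ℝ} (hd : 0 ≤ d)
    (hd' : ∀ x y : ℝ, 0 ≤ x → 0 ≤ y → |x ^ 2 - resonanceCenter τ ξ η p| ≤ 4 * c ^ 2 * L / n →
      |y ^ 2 - resonanceCenter τ ξ η p| ≤ 4 * c ^ 2 * L / n → |x - y| ≤ d) :
    ∃ F : Finset ℤ, (∀ η₁ : ℤ, (p, η₁) ∈ resonantSet c N n (2 * c * L) τ ξ η → η₁ ∈ F) ∧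
      (F.card : ℝ) ≤ 2 * (1 + 2 * c ^ 3 * n * d) := by
  have hN0 : 0 < N := lt_of_lt_of_le (by positivity) hN
  have hp := abs_pos.1 (h.fst_pos hc hN0)
  have hs := abs_pos.1 (h.snd_pos hc (by linarith))
  have hx := abs_pos.1 (lt_of_lt_of_le (by positivity) (h.output_lower hc hn hN))
  obtain ⟨F, hF, hFc⟩ := exists_finset_card_le_of_sq_near (a := (ξ : ℝ) / (p * (ξ - p)))
    (a₀ := 1 / (2 * c ^ 3 * n)) (b := -((η : ℝ) / (ξ - p))) (A := resonanceCenter τ ξ η p)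
    (r := 4 * c ^ 2 * L / n) (d := d) (by positivity) (h.ratio_lower hc hn hN) hd hd'
  refine ⟨F, fun η₁ hη => hF ?_, hFc.trans_eq (by field_simp)⟩
  have h2 := hη.2
  simp only at h2
  rw [sub_omega_sub_omega_eq τ η η₁ (by exact_mod_cast hx) (by exact_mod_cast hp)
    (by exact_mod_cast hs), abs_mul] at h2
  -- Dividing out the leading coefficient costs at most `2c/n`, so `2cL` becomes the radius
  -- `4c²L/n`.
  have hratio := h.ratio_upper hc hn hN
  have hinv : |(ξ : ℝ) / (p * (ξ - p))| * |(p : ℝ) * (ξ - p) / ξ| = 1 := by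
    rw [← abs_mul]
    have : (ξ : ℝ) / (p * (ξ - p)) * ((p : ℝ) * (ξ - p) / ξ) = 1 := by field_simp
    rw [this, abs_one]
  have h3 := mul_le_mul hratio h2 (by positivity) (by positivity)
  rw [← mul_assoc, hinv, one_mul] at h3
  exact h3.trans_eq (by ring)

lemma sqrt_le_of_le_sq {a b : ℝ} (hb : 0 ≤ b) (h : a ≤ b ^ 2) : √a ≤ b :=
  Real.sqrt_le_iff.2 ⟨hb, h⟩

/-- Fibre count without using the position of the center. -/
lemma exists_finset_fibre_uniform {c N n L τ : ℝ} {ξ η p : ℤ} (hc : 1 ≤ c) (hn : 1 ≤ n)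
    (hN : 4 * c ^ 2 * n ≤ N) (hL : 0 ≤ L) (h : FreqBounds c N n ξ p) :
    ∃ F : Finset ℤ, (∀ η₁ : ℤ, (p, η₁) ∈ resonantSet c N n (2 * c * L) τ ξ η → η₁ ∈ F) ∧
      (F.card : ℝ) ≤ 2 * (1 + 6 * c ^ 4 * √(L * n)) := by
  -- `d² = 9c²L/n` dominates twice the radius, `8c²L/n`.
  obtain ⟨F, hF, hFc⟩ := exists_finset_fibre (d := 3 * c * √(L * n) / n) (L := L) (τ := τ) (η := η)
    hc hn hN h (by positivity) (fun x y hx hy hxA hyA => by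
      have h1 := sq_abs_sub_le_of_sq_near hx hy hxA hyA
      refine (abs_le_of_sq_le_sq' (h1.trans ?_) (by positivity)).2
      rw [div_pow, mul_pow, Real.sq_sqrt (by positivity)]
      have : (3 * c) ^ 2 * (L * n) / n ^ 2 - 2 * (4 * c ^ 2 * L / n) = c ^ 2 * L / n := by
        field_simp; ring
      have : 0 ≤ c ^ 2 * L / n := by positivity
      linarith)
  exact ⟨F, hF, hFc.trans_eq (by field_simp; ring)⟩

/-- Fibre count away from the center of smallest modulus. -/
lemma exists_finset_fibre_of_center {c N n L τ : ℝ} {ξ η p q : ℤ} (hc : 1 ≤ c) (hn : 1 ≤ n)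
    (hN : 4 * c ^ 2 * n ≤ N) (hL : 0 ≤ L) (h : FreqBounds c N n ξ p) (h' : FreqBounds c N n ξ q)
    (hle : |resonanceCenter τ ξ η q| ≤ |resonanceCenter τ ξ η p|) (hpq : p ≠ q) :
    ∃ F : Finset ℤ, (∀ η₁ : ℤ, (p, η₁) ∈ resonantSet c N n (2 * c * L) τ ξ η → η₁ ∈ F) ∧
      (F.card : ℝ) ≤ 2 * (1 + 48 * c ^ 8 * L * √n / N * (1 / √|(p : ℝ) - q|)) := by
  have hN0 : 0 < N := lt_of_lt_of_le (by positivity) hN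
  have hk : 0 < |(p : ℝ) - q| := abs_pos.2 (sub_ne_zero.2 (by exact_mod_cast hpq))
  have hn0 : 0 < √n := Real.sqrt_pos.2 (by linarith)
  have hk0 : 0 < √|(p : ℝ) - q| := Real.sqrt_pos.2 hk
  have hA : N * √|(p : ℝ) - q| / (3 * c ^ 3 * √n) ≤ √|resonanceCenter τ ξ η p| := by
    apply Real.le_sqrt_of_sq_le
    refine le_trans ?_ (h.center_lower h' hc hn hN hle)
    rw [div_pow, mul_pow, Real.sq_sqrt hk.le, mul_pow, Real.sq_sqrt (by linarith)]
    have hc5 : c ^ 5 ≤ c ^ 6 := pow_le_pow_right₀ hc (by norm_num)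
    have : 8 * c ^ 5 ≤ (3 * c ^ 3) ^ 2 := by
      have : 0 ≤ c ^ 6 := by positivity
      nlinarith
    gcongr
  -- `d` is twice the radius `4c²L/n` divided by the lower bound `hA` for the root of the center.
  obtain ⟨F, hF, hFc⟩ := exists_finset_fibre
    (d := 24 * c ^ 5 * L * √n / (n * N) * (1 / √|(p : ℝ) - q|)) (L := L) (τ := τ) (η := η)
    hc hn hN h (by positivity) (fun x y hx hy hxA hyA => by
      have h1 := (mul_le_mul_of_nonneg_left hA (abs_nonneg (x - y))).trans
        (abs_sub_mul_sqrt_le_of_sq_near hx hy hxA hyA)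
      rw [← mul_div_assoc, div_le_iff₀ (by positivity), ← mul_assoc, ← le_div_iff₀ hk0,
        ← le_div_iff₀ hN0] at h1
      exact h1.trans_eq (by field_simp; ring))
  refine ⟨F, hF, hFc.trans_eq ?_⟩
  field_simp
  ring

/-- The three terms come from the number of frequencies `p`, from the one exceptional fibre over
`q`, and from the remaining fibres; `600` dominates their constants `6`, `12` and `576`. -/
lemma exists_finset_resonantSet {c N n L : ℝ} (τ : ℝ) (ξ η : ℤ) (hc : 1 ≤ c) (hn : 1 ≤ n)
    (hN : 4 * c ^ 2 * n ≤ N) (hL : 0 ≤ L) :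
    ∃ F : Finset (ℤ × ℤ), resonantSet c N n (2 * c * L) τ ξ η ⊆ F ∧
      (F.card : ℝ) ≤ 600 * c ^ 9 * (n + √(L * n) + L * n / N) := by
  classical
  have hN0 : 0 < N := lt_of_lt_of_le (by positivity) hN
  obtain ⟨X₀, hX₀, hX₀c⟩ := exists_finset_card_le_of_dist_le
    {p : ℤ | FreqBounds c N n ξ p} (a := 1) (d := 2 * c * n) one_pos (by positivity)
    (fun p hp q hq => by
      have := abs_sub ((ξ : ℝ) - q) (ξ - p)
      rw [show (ξ : ℝ) - q - (ξ - p) = p - q by ring] at this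
      linarith [hp.snd_upper, hq.snd_upper])
  set X := X₀.filter (fun p : ℤ => FreqBounds c N n ξ p) with hX
  have hXmem : ∀ p : ℤ, p ∈ X ↔ FreqBounds c N n ξ p := fun p => by
    rw [hX, Finset.mem_filter]
    exact ⟨fun h => h.2, fun h => ⟨hX₀ h, h⟩⟩
  have hXc : (X.card : ℝ) ≤ 3 * c * n := by
    have h1 : (X.card : ℝ) ≤ X₀.card := by exact_mod_cast Finset.card_filter_le _ _
    have h2 : 1 ≤ c * n := by nlinarith
    linarith
  rcases X.eq_empty_or_nonempty with hXe | hXne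
  · refine ⟨∅, fun p hp => ?_, ?_⟩
    · have := (hXmem p.1).2 hp.1
      simp [hXe] at this
    · rw [Finset.card_empty, Nat.cast_zero]
      positivity
  obtain ⟨q, hq, hmin⟩ := X.exists_min_image (fun p => |resonanceCenter τ ξ η p|) hXne
  have hfib : ∀ p : ℤ, ∃ F : Finset ℤ, p ∈ X →
      ((∀ η₁ : ℤ, (p, η₁) ∈ resonantSet c N n (2 * c * L) τ ξ η → η₁ ∈ F) ∧
      (F.card : ℝ) ≤ if p = q then 2 * (1 + 6 * c ^ 4 * √(L * n)) else
        2 * (1 + 48 * c ^ 8 * L * √n / N * (1 / √|(p : ℝ) - q|))) := by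
    intro p
    by_cases hp : p ∈ X
    · by_cases hpq : p = q
      · obtain ⟨F, hF⟩ := exists_finset_fibre_uniform (τ := τ) (η := η) hc hn hN hL ((hXmem p).1 hp)
        exact ⟨F, fun _ => by rwa [if_pos hpq]⟩
      · obtain ⟨F, hF⟩ := exists_finset_fibre_of_center (τ := τ) (η := η) hc hn hN hL
          ((hXmem p).1 hp) ((hXmem q).1 hq) (hmin p hp) hpq
        exact ⟨F, fun _ => by rwa [if_neg hpq]⟩
    · exact ⟨∅, fun h => absurd h hp⟩
  choose F hF using hfib
  refine ⟨X.biUnion fun p => (F p).image (fun e => (p, e)), fun z hz => ?_, ?_⟩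
  · have hz1 := (hXmem z.1).2 hz.1
    rw [Finset.mem_coe, Finset.mem_biUnion]
    exact ⟨z.1, hz1, Finset.mem_image.2 ⟨z.2, (hF z.1 hz1).1 z.2 hz, rfl⟩⟩
  have hcard : ((X.biUnion fun p => (F p).image (fun e => (p, e))).card : ℝ) ≤
      ∑ p ∈ X, ((F p).card : ℝ) := by
    refine le_trans (Nat.cast_le.2 Finset.card_biUnion_le) ?_
    push_cast
    exact Finset.sum_le_sum fun p _ => by exact_mod_cast Finset.card_image_le
  have hdist : ∀ p ∈ X, |p - q| ≤ (⌊2 * c * n⌋₊ : ℤ) := fun p hp => by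
    have h1 := abs_sub ((ξ : ℝ) - q) (ξ - p)
    rw [show (ξ : ℝ) - q - (ξ - p) = p - q by ring] at h1
    rw [Int.natCast_floor_eq_floor (by positivity), Int.le_floor]
    push_cast
    linarith [((hXmem p).1 hp).snd_upper, ((hXmem q).1 hq).snd_upper]
  have hsqrt : ∑ p ∈ X.erase q, 1 / √|(p : ℝ) - q| ≤ 6 * c * √n := by
    refine (sum_inv_sqrt_abs_sub_le X q _ hdist).trans ?_
    have h1 : √(⌊2 * c * n⌋₊ : ℝ) ≤ 3 / 2 * c * √n := by
      apply sqrt_le_of_le_sq (by positivity)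
      rw [mul_pow, Real.sq_sqrt (by linarith)]
      refine (Nat.floor_le (by positivity)).trans ?_
      have : 0 ≤ c * n := by positivity
      nlinarith
    linarith
  have hsum : ∑ p ∈ X, ((F p).card : ℝ) ≤ 2 * (X.card : ℝ) + 12 * c ^ 4 * √(L * n) +
      96 * c ^ 8 * L * √n / N * (6 * c * √n) := by
    refine (Finset.sum_le_sum fun p hp => (hF p hp).2).trans ?_
    rw [← Finset.add_sum_erase _ _ hq, if_pos rfl,
      Finset.sum_congr rfl fun p hp => if_neg (Finset.ne_of_mem_erase hp), ← Finset.mul_sum,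
      Finset.sum_add_distrib, ← Finset.mul_sum, Finset.sum_const, nsmul_eq_mul, mul_one]
    have h1 := mul_le_mul_of_nonneg_left hsqrt
      (show 0 ≤ 96 * c ^ 8 * L * √n / N by positivity)
    have h2 : ((X.erase q).card : ℝ) + 1 = X.card := by
      exact_mod_cast Finset.card_erase_add_one hq
    rw [← h2]
    linarith [h1, show 96 * c ^ 8 * L * √n / N * ∑ p ∈ X.erase q, 1 / √|(p : ℝ) - q| =
      2 * (48 * c ^ 8 * L * √n / N * ∑ p ∈ X.erase q, 1 / √|(p : ℝ) - q|) by ring]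
  have hlast : 96 * c ^ 8 * L * √n / N * (6 * c * √n) = 576 * c ^ 9 * (L * n / N) := by
    have : √n * √n = n := Real.mul_self_sqrt (by linarith)
    calc _ = 576 * c ^ 9 * (L * (√n * √n) / N) := by ring
      _ = _ := by rw [this]
  have hc1 : c ≤ c ^ 9 := by simpa using pow_le_pow_right₀ hc (show 1 ≤ 9 by norm_num)
  have hc4 : c ^ 4 ≤ c ^ 9 := pow_le_pow_right₀ hc (by norm_num)
  have e1 : c * n ≤ c ^ 9 * n := by gcongr
  have e2 : c ^ 4 * √(L * n) ≤ c ^ 9 * √(L * n) := by gcongr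
  have e3 : 0 ≤ c ^ 9 * (L * n / N) := by positivity
  have e4 : 0 ≤ c ^ 9 * √(L * n) := by positivity
  have e5 : 0 ≤ c ^ 9 * n := by positivity
  linarith

/-! ### `L²` bounds for convolutions from the measure of contributing sets -/

section Convolution

open scoped ENNReal

/-- Cauchy–Schwarz against the indicator of `E`. -/
lemma sq_lintegral_le_measure_mul {α : Type*} [MeasurableSpace α] {ν : Measure α} {h : α → ℝ≥0∞}
    {E : Set α} (hE : MeasurableSet E) (hh : AEMeasurable h ν) (hs : ∀ t, h t ≠ 0 → t ∈ E) :
    (∫⁻ t, h t ∂ν) ^ 2 ≤ ν E * ∫⁻ t, h t ^ 2 ∂ν := by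
  have h1 : ∫⁻ t, h t ∂ν = ∫⁻ t, ((E.indicator 1 : α → ℝ≥0∞) * h) t ∂ν := lintegral_congr fun t => by
    by_cases ht : t ∈ E
    · simp [ht]
    · have : h t = 0 := by by_contra h0; exact ht (hs t h0)
      simp [this]
  have h2 := ENNReal.lintegral_mul_le_Lp_mul_Lq ν Real.HolderConjugate.two_two
    ((measurable_one.indicator hE).aemeasurable (μ := ν)) hh
  have h3 : ∫⁻ t, (E.indicator (1 : α → ℝ≥0∞) t) ^ (2 : ℝ) ∂ν = ν E := by
    rw [← lintegral_indicator_one hE]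
    refine lintegral_congr fun t => ?_
    by_cases ht : t ∈ E <;> simp [ht]
  rw [← h1, h3, ← ENNReal.mul_rpow_of_nonneg _ _ (by norm_num)] at h2
  have h4 := pow_le_pow_left₀ (zero_le) h2 2
  rw [← ENNReal.rpow_natCast (_ ^ _), ← ENNReal.rpow_mul] at h4
  norm_num at h4
  exact h4

lemma eLpNorm_two_sq {α : Type*} [MeasurableSpace α] {μ : Measure α} (f : α → ℂ) :
    eLpNorm f 2 μ ^ 2 = ∫⁻ x, ‖f x‖ₑ ^ 2 ∂μ := by
  have := eLpNorm_nnreal_pow_eq_lintegral (μ := μ) (f := f) (p := 2) (by norm_num)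
  simpa using this

variable {G : Type*} [AddCommGroup G] [MeasurableSpace G] [MeasurableAdd₂ G] [MeasurableNeg G]
  {μ : Measure G} [μ.IsAddLeftInvariant] {f g : G → ℂ}

lemma convolutionExists_of_memLp_two [μ.IsNegInvariant] (hf : MemLp f 2 μ) (hg : MemLp g 2 μ) :
    ConvolutionExists f g (ContinuousLinearMap.mul ℂ ℂ) μ := fun x =>
  hf.integrable_mul (hg.comp_measurePreserving (Measure.measurePreserving_sub_left μ x))

lemma aestronglyMeasurable_convolution [SFinite μ] (hf : AEStronglyMeasurable f μ)
    (hg : AEStronglyMeasurable g μ) :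
    AEStronglyMeasurable (convolution f g (ContinuousLinearMap.mul ℂ ℂ) μ) μ :=
  (hf.convolution_integrand (μ := μ) (ContinuousLinearMap.mul ℂ ℂ) hg).integral_prod_right'

/-- The `L²` bound for a convolution by the size of the sets of contributing points. -/
lemma lintegral_sq_convolution_le [SFinite μ] [μ.IsNegInvariant]
    (hf : AEStronglyMeasurable f μ) (hg : AEStronglyMeasurable g μ)
    {B : ℝ≥0∞}
    (hB : ∀ x, ∃ E, MeasurableSet E ∧ (∀ t, f t ≠ 0 → g (x - t) ≠ 0 → t ∈ E) ∧ μ E ≤ B) :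
    ∫⁻ x, ‖convolution f g (ContinuousLinearMap.mul ℂ ℂ) μ x‖ₑ ^ 2 ∂μ ≤
      B * ((∫⁻ x, ‖f x‖ₑ ^ 2 ∂μ) * ∫⁻ x, ‖g x‖ₑ ^ 2 ∂μ) := by
  have hmeas : AEMeasurable (fun p : G × G => ‖f p.2 * g (p.1 - p.2)‖ₑ ^ 2) (μ.prod μ) :=
    (hf.convolution_integrand (μ := μ) (ContinuousLinearMap.mul ℂ ℂ) hg).enorm.pow_const 2
  have hpt : ∀ x, ‖convolution f g (ContinuousLinearMap.mul ℂ ℂ) μ x‖ₑ ^ 2 ≤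
      B * ∫⁻ t, ‖f t * g (x - t)‖ₑ ^ 2 ∂μ := fun x => by
    obtain ⟨E, hE, hsub, hEB⟩ := hB x
    calc _ ≤ (∫⁻ t, ‖f t * g (x - t)‖ₑ ∂μ) ^ 2 :=
          pow_le_pow_left₀ zero_le (enorm_integral_le_lintegral_enorm _) 2
      _ ≤ μ E * ∫⁻ t, ‖f t * g (x - t)‖ₑ ^ 2 ∂μ := by
          refine sq_lintegral_le_measure_mul hE ?_ fun t ht => ?_
          · exact (hf.mul (hg.comp_measurePreserving
              (Measure.measurePreserving_sub_left μ x))).enorm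
          · rw [enorm_ne_zero] at ht
            exact hsub t (left_ne_zero_of_mul ht) (right_ne_zero_of_mul ht)
      _ ≤ _ := by gcongr
  calc _ ≤ ∫⁻ x, B * ∫⁻ t, ‖f t * g (x - t)‖ₑ ^ 2 ∂μ ∂μ := lintegral_mono hpt
    _ = B * ∫⁻ x, ∫⁻ t, ‖f t * g (x - t)‖ₑ ^ 2 ∂μ ∂μ :=
        lintegral_const_mul'' _ hmeas.lintegral_prod_right'
    _ = B * ∫⁻ t, ∫⁻ x, ‖f t * g (x - t)‖ₑ ^ 2 ∂μ ∂μ := by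
        rw [lintegral_lintegral_swap hmeas]
    _ = B * ∫⁻ t, ‖f t‖ₑ ^ 2 * ∫⁻ x, ‖g x‖ₑ ^ 2 ∂μ ∂μ := by
        congr 1
        refine lintegral_congr fun t => ?_
        simp_rw [enorm_mul, mul_pow]
        have hgt : AEMeasurable (fun x => ‖g (x - t)‖ₑ ^ 2) μ :=
          (hg.comp_measurePreserving (measurePreserving_sub_right μ t)).enorm.pow_const 2
        rw [lintegral_const_mul'' _ hgt, lintegral_sub_right_eq_self (fun x => ‖g x‖ₑ ^ 2) t]
    _ = _ := by
        rw [lintegral_mul_const'' _ (hf.enorm.pow_const 2)]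

lemma memLp_convolution_and_eLpNorm_le [SFinite μ] [μ.IsNegInvariant]
    (hf : MemLp f 2 μ) (hg : MemLp g 2 μ) {B : ℝ} (hB0 : 0 ≤ B)
    (hB : ∀ x, ∃ E, MeasurableSet E ∧ (∀ t, f t ≠ 0 → g (x - t) ≠ 0 → t ∈ E) ∧
      μ E ≤ ENNReal.ofReal (B ^ 2)) :
    MemLp (convolution f g (ContinuousLinearMap.mul ℂ ℂ) μ) 2 μ ∧
      (eLpNorm (convolution f g (ContinuousLinearMap.mul ℂ ℂ) μ) 2 μ).toReal ≤
        B * ((eLpNorm f 2 μ).toReal * (eLpNorm g 2 μ).toReal) := by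
  have h := lintegral_sq_convolution_le hf.1 hg.1 hB
  rw [← eLpNorm_two_sq, ← eLpNorm_two_sq, ← eLpNorm_two_sq, ENNReal.ofReal_pow hB0, ← mul_pow,
    ← mul_pow, ENNReal.pow_le_pow_left_iff two_ne_zero] at h
  have htop : ENNReal.ofReal B * (eLpNorm f 2 μ * eLpNorm g 2 μ) ≠ ∞ :=
    ENNReal.mul_ne_top ENNReal.ofReal_ne_top (ENNReal.mul_ne_top hf.2.ne hg.2.ne)
  refine ⟨⟨aestronglyMeasurable_convolution hf.1 hg.1, h.trans_lt htop.lt_top⟩, ?_⟩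
  have := ENNReal.toReal_mono htop h
  rwa [ENNReal.toReal_mul, ENNReal.toReal_mul, ENNReal.toReal_ofReal hB0] at this

end Convolution

/-! ### Measure of the contributing sets in frequency space -/

instance : SFinite freqMeasure := by unfold freqMeasure; infer_instance

instance : freqMeasure.IsAddLeftInvariant := by unfold freqMeasure; infer_instance

instance : freqMeasure.IsNegInvariant where
  neg_eq_self := by
    unfold freqMeasure
    exact ((Measure.measurePreserving_neg (volume : Measure ℝ)).prod
      ((Measure.measurePreserving_neg (Measure.count : Measure ℤ)).prod
        (Measure.measurePreserving_neg (Measure.count : Measure ℤ)))).map_eq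

lemma freqMeasure_prod_singleton (I : Set ℝ) (p : ℤ × ℤ) :
    freqMeasure (I ×ˢ {p}) = volume I := by
  have : ({p} : Set (ℤ × ℤ)) = {p.1} ×ˢ {p.2} := by simp
  rw [freqMeasure, Measure.prod_prod, this, Measure.prod_prod]
  simp

/-- The points contributing to the convolution at `x` lie over few frequencies, in an interval
over each. -/
lemma exists_measurableSet_contributing {c N n L₁ L₂ : ℝ} (hc : 1 ≤ c) (hn : 1 ≤ n)
    (hN : 4 * c ^ 2 * n ≤ N) (h₁ : 0 ≤ L₁) (h₂ : 0 ≤ L₂) {f₁ f₂ : Freq → ℂ}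
    (hf₁ : LocalizedAt c N L₁ f₁) (hf₂ : LocalizedAt c n L₂ f₂) (x : Freq) :
    ∃ E, MeasurableSet E ∧ (∀ t, f₁ t ≠ 0 → f₂ (x - t) ≠ 0 → t ∈ E) ∧
      freqMeasure E ≤ ENNReal.ofReal (2 * c * min L₁ L₂ *
        (600 * c ^ 9 * (n + √(max L₁ L₂ * n) + max L₁ L₂ * n / N))) := by
  obtain ⟨τ, ξ, η⟩ := x
  obtain ⟨F, hF, hFc⟩ := exists_finset_resonantSet (L := max L₁ L₂) τ ξ η hc hn hN
    (h₁.trans (le_max_left _ _))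
  -- The interval comes from whichever modulation constraint is narrower, which gives `min L₁ L₂`.
  have hI : ∃ I : ℤ × ℤ → Set ℝ, (∀ p, MeasurableSet (I p)) ∧
      (∀ p, volume (I p) = ENNReal.ofReal (2 * c * min L₁ L₂)) ∧
      ∀ s : ℝ, ∀ p : ℤ × ℤ, |s - omega p.1 p.2| ≤ c * L₁ →
        |τ - s - omega (ξ - p.1) (η - p.2)| ≤ c * L₂ → s ∈ I p := by
    rcases le_total L₁ L₂ with h | h
    · refine ⟨fun p => Metric.closedBall (omega p.1 p.2) (c * L₁),
        fun p => measurableSet_closedBall, fun p => ?_, fun s p hs _ => hs⟩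
      rw [Real.volume_closedBall, min_eq_left h, mul_assoc]
    · refine ⟨fun p => Metric.closedBall (τ - omega (ξ - p.1) (η - p.2)) (c * L₂),
        fun p => measurableSet_closedBall, fun p => ?_, fun s p _ hs => ?_⟩
      · rw [Real.volume_closedBall, min_eq_right h, mul_assoc]
      · rw [Metric.mem_closedBall, Real.dist_eq, abs_sub_comm]
        rwa [sub_right_comm] at hs
  obtain ⟨I, hIm, hIv, hImem⟩ := hI
  refine ⟨⋃ p ∈ F, I p ×ˢ {p}, ?_, ?_, ?_⟩
  · exact Finset.measurableSet_biUnion _ fun p _ => (hIm p).prod (measurableSet_singleton p)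
  · rintro ⟨s, p, e⟩ ht ht'
    obtain ⟨⟨a1, a2⟩, a3⟩ := hf₁ s p e ht
    obtain ⟨⟨b1, b2⟩, b3⟩ := hf₂ (τ - s) (ξ - p) (η - e) ht'
    -- Adding the two modulation constraints eliminates `s` and bounds the resonance function by `2c
    -- max L₁ L₂`.
    have hmem : (p, e) ∈ F := hF ⟨⟨a1, a2, by exact_mod_cast b1, by exact_mod_cast b2⟩, by
      have := abs_add_le (s - omega p e) (τ - s - omega (ξ - p) (η - e))
      rw [show s - omega p e + (τ - s - omega (ξ - p) (η - e)) =
        τ - omega p e - omega (ξ - p) (η - e) by ring] at this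
      have m1 := mul_le_mul_of_nonneg_left (le_max_left L₁ L₂) (by linarith : 0 ≤ c)
      have m2 := mul_le_mul_of_nonneg_left (le_max_right L₁ L₂) (by linarith : 0 ≤ c)
      dsimp only
      linarith⟩
    exact Set.mem_biUnion hmem ⟨hImem s (p, e) a3 b3, rfl⟩
  · calc freqMeasure (⋃ p ∈ F, I p ×ˢ {p}) ≤ ∑ p ∈ F, freqMeasure (I p ×ˢ {p}) :=
          measure_biUnion_finset_le _ _
      _ = ENNReal.ofReal (2 * c * min L₁ L₂ * F.card) := by
          simp_rw [freqMeasure_prod_singleton, hIv]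
          rw [Finset.sum_const, nsmul_eq_mul, mul_comm (2 * c * _),
            ENNReal.ofReal_mul (Nat.cast_nonneg F.card), ENNReal.ofReal_natCast]
      _ ≤ _ := by
          have : 0 ≤ min L₁ L₂ := le_min h₁ h₂
          exact ENNReal.ofReal_le_ofReal (by gcongr)

/-! ### Comparison of exponents and conclusion -/

/-- Comparison of the counting bound with the claimed one. -/
lemma count_le_of_rpow_le {α n N L : ℝ} (hα : α ≤ 1) (hn : 1 ≤ n) (hN : 1 ≤ N)
    (hL : N ^ α ≤ L) :
    n + √(L * n) + L * n / N ≤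
      2 * (L * ((n ^ (1 / 2 : ℝ) * N ^ (-α / 2)) ^ 2 + (n ^ (1 / 4 : ℝ) * N ^ (-α / 4)) ^ 2)) := by
  have hN0 : 0 < N := by linarith
  have hn0 : 0 ≤ n := by linarith
  have hNα : 0 < N ^ α := Real.rpow_pos_of_pos hN0 _
  have hL0 : 0 < L := hNα.trans_le hL
  have hu : (n ^ (1 / 2 : ℝ) * N ^ (-α / 2)) ^ 2 = n * N ^ (-α) := by
    rw [mul_pow, ← Real.rpow_natCast, ← Real.rpow_natCast, ← Real.rpow_mul hn0,
      ← Real.rpow_mul hN0.le]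
    norm_num
  have hv : (n ^ (1 / 4 : ℝ) * N ^ (-α / 4)) ^ 2 = √n * √(N ^ (-α)) := by
    rw [mul_pow, ← Real.rpow_natCast, ← Real.rpow_natCast, ← Real.rpow_mul hn0,
      ← Real.rpow_mul hN0.le, Real.sqrt_eq_rpow, Real.sqrt_eq_rpow, ← Real.rpow_mul hN0.le]
    congr 2 <;> push_cast <;> ring
  have hinv : N ^ (-α) = (N ^ α)⁻¹ := Real.rpow_neg hN0.le _
  have h1 : 1 ≤ L * N ^ (-α) := by
    rw [hinv, ← div_eq_mul_inv, le_div_iff₀ hNα, one_mul]; exact hL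
  have h2 : 1 / N ≤ N ^ (-α) := by
    rw [hinv, one_div]
    refine inv_anti₀ hNα ?_
    simpa using Real.rpow_le_rpow_of_exponent_le hN hα
  -- Squared, this is `L ≤ L · (L N^(-α))`, which follows from `h1`.
  have h3 : √L ≤ L * √(N ^ (-α)) := by
    apply Real.sqrt_le_iff.2 ⟨by positivity, ?_⟩
    rw [mul_pow, Real.sq_sqrt (by positivity)]
    nlinarith
  rw [hu, hv, Real.sqrt_mul hL0.le]
  have e1 : n ≤ L * (n * N ^ (-α)) := by nlinarith
  have e2 : √L * √n ≤ L * (√n * √(N ^ (-α))) := by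
    nlinarith [mul_le_mul_of_nonneg_right h3 (Real.sqrt_nonneg n)]
  have e3 : L * n / N ≤ L * (n * N ^ (-α)) := by
    rw [← mul_assoc, div_eq_mul_one_div]
    gcongr
  have e4 : 0 ≤ L * (√n * √(N ^ (-α))) := by positivity
  linarith

lemma IsDyadic.one_le {x : ℝ} (h : IsDyadic x) : 1 ≤ x := by
  obtain ⟨k, rfl⟩ := h
  exact one_le_pow₀ (by norm_num)

end KPII

theorem mainTheorem10 :
    ∀ c : ℝ, 1 ≤ c → ∃ K : ℝ, 0 < K ∧ ∃ C : ℝ, 0 < C ∧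
      ∀ (α : ℝ), α ≤ 1 →
      ∀ (N₁ N₂ L₁ L₂ D : ℝ),
        KPII.IsDyadic N₁ → KPII.IsDyadic N₂ → KPII.IsDyadic L₁ → KPII.IsDyadic L₂ →
        2 ≤ D → K * N₂ ≤ N₁ →
        N₁ ^ α ≤ max L₁ L₂ → max L₁ L₂ ≤ c * (N₁ ^ 2 * N₂) →
      ∀ f₁ f₂ : KPII.Freq → ℂ,
        MeasureTheory.MemLp f₁ 2 KPII.freqMeasure →
        MeasureTheory.MemLp f₂ 2 KPII.freqMeasure →
        KPII.LocalizedAt c N₁ L₁ f₁ → KPII.LocalizedAt c N₂ L₂ f₂ →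
        KPII.TransversalityLE c D f₁ f₂ →
        MeasureTheory.ConvolutionExists f₁ f₂ (ContinuousLinearMap.mul ℂ ℂ) KPII.freqMeasure ∧
        MeasureTheory.MemLp
          (MeasureTheory.convolution f₁ f₂ (ContinuousLinearMap.mul ℂ ℂ) KPII.freqMeasure)
          2 KPII.freqMeasure ∧
        (MeasureTheory.eLpNorm
          (MeasureTheory.convolution f₁ f₂ (ContinuousLinearMap.mul ℂ ℂ) KPII.freqMeasure)
          2 KPII.freqMeasure).toReal ≤
          C * Real.log D *
            (N₂ ^ (1 / 2 : ℝ) * N₁ ^ (-α / 2) + N₂ ^ (1 / 4 : ℝ) * N₁ ^ (-α / 4)) *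
            ((L₁ ^ (1 / 2 : ℝ) * (MeasureTheory.eLpNorm f₁ 2 KPII.freqMeasure).toReal) *
              (L₂ ^ (1 / 2 : ℝ) * (MeasureTheory.eLpNorm f₂ 2 KPII.freqMeasure).toReal)) := by
  intro c hc
  have hlog2 : 0 < Real.log 2 := Real.log_pos (by norm_num)
  -- The measure bound has constant `2c · 600c⁹ · 2 = 2400c¹⁰ ≤ (49c⁵)²`.
  refine ⟨4 * c ^ 2, by positivity, 49 * c ^ 5 / Real.log 2, by positivity, ?_⟩
  intro α hα N₁ N₂ L₁ L₂ D hN₁ hN₂ hL₁ hL₂ hD hK hlow _ f₁ f₂ hf₁ hf₂ hloc₁ hloc₂ _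
  have hN₁ := hN₁.one_le
  have hN₂ := hN₂.one_le
  have hL₁ := hL₁.one_le
  have hL₂ := hL₂.one_le
  refine ⟨KPII.convolutionExists_of_memLp_two hf₁ hf₂, ?_⟩
  set u := N₂ ^ (1 / 2 : ℝ) * N₁ ^ (-α / 2) with hu
  set v := N₂ ^ (1 / 4 : ℝ) * N₁ ^ (-α / 4) with hv
  have hu0 : 0 ≤ u := by positivity
  have hv0 : 0 ≤ v := by positivity
  have hs₁ : (L₁ ^ (1 / 2 : ℝ)) ^ 2 = L₁ := by
    rw [← Real.sqrt_eq_rpow, Real.sq_sqrt (by linarith)]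
  have hs₂ : (L₂ ^ (1 / 2 : ℝ)) ^ 2 = L₂ := by
    rw [← Real.sqrt_eq_rpow, Real.sq_sqrt (by linarith)]
  set B := 49 * c ^ 5 * (u + v) * (L₁ ^ (1 / 2 : ℝ) * L₂ ^ (1 / 2 : ℝ)) with hB
  have hB0 : 0 ≤ B := by positivity
  have hcount := KPII.count_le_of_rpow_le hα hN₂ hN₁ hlow
  rw [← hu, ← hv] at hcount
  have hmin : 0 ≤ min L₁ L₂ := le_min (by linarith) (by linarith)
  have hBsq : 2 * c * min L₁ L₂ * (600 * c ^ 9 *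
      (N₂ + √(max L₁ L₂ * N₂) + max L₁ L₂ * N₂ / N₁)) ≤ B ^ 2 := by
    calc _ ≤ 2 * c * min L₁ L₂ * (600 * c ^ 9 * (2 * (max L₁ L₂ * (u ^ 2 + v ^ 2)))) := by gcongr
      _ = 2400 * c ^ 10 * (u ^ 2 + v ^ 2) * (min L₁ L₂ * max L₁ L₂) := by ring
      _ = 2400 * c ^ 10 * (u ^ 2 + v ^ 2) * (L₁ * L₂) := by rw [min_mul_max]
      _ ≤ 2401 * c ^ 10 * (u + v) ^ 2 * (L₁ * L₂) := by
        gcongr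
        · norm_num
        · nlinarith [mul_nonneg hu0 hv0]
      _ = B ^ 2 := by
        rw [hB, mul_pow, mul_pow (L₁ ^ _), hs₁, hs₂]
        ring
  obtain ⟨hmem, hle⟩ := KPII.memLp_convolution_and_eLpNorm_le hf₁ hf₂ hB0 fun x => by
    obtain ⟨E, hE, hsub, hm⟩ := KPII.exists_measurableSet_contributing hc hN₂ hK
      (by linarith) (by linarith) hloc₁ hloc₂ x
    exact ⟨E, hE, hsub, hm.trans (ENNReal.ofReal_le_ofReal hBsq)⟩
  refine ⟨hmem, hle.trans ?_⟩
  -- The estimate already holds with `B`; the logarithm enters only as a factor `log D / log 2 ≥ 1`.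
  have hlog : 1 ≤ Real.log D / Real.log 2 := by
    rw [one_le_div hlog2]
    exact Real.log_le_log (by norm_num) hD
  set a := (MeasureTheory.eLpNorm f₁ 2 KPII.freqMeasure).toReal
  set b := (MeasureTheory.eLpNorm f₂ 2 KPII.freqMeasure).toReal
  have hP : 0 ≤ B * (a * b) := by positivity
  calc B * (a * b) ≤ Real.log D / Real.log 2 * (B * (a * b)) := le_mul_of_one_le_left hP hlog
    _ = _ := by rw [hB]; ring
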